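/- Let $n\ge 2$ be an integer. Let $B_n$ be the Artin braid group with generators $\sigma_1,\dots,\sigma_{n-1}$ and relations $\sigma_i\sigma_{i+1}\sigma_i=\sigma_{i+1}\sigma_i\sigma_{i+1}$ ($1\le i\le n-2$) and $\sigma_i\sigma_j=\sigma_j\sigma_i$ ($|i-j|\ge 2$), and let $\widehat{B}_n$ be its profinite completion. Put $\zeta_n=(\sigma_1\sigma_2\cdots\sigma_{n-1})^n$, a central element of $\widehat{B}_n$, let $\widehat{C}_n=\overline{\langle\zeta_n\rangle}\subset\widehat{B}_n$ be the closed subgroup topologically generated by $\zeta_n$, and put $\widehat{\mathcal{B}}_n=\widehat{B}_n/\widehat{C}_n$. For a profinite integer $e\in\widehat{\mathbb{Z}}$, $\zeta_n^e$ denotes the profinite power. Let $\mathrm{Aut}$ denote the group of continuous automorphisms, and let $$\ker(\mathfrak{p}_1)\subset\mathrm{Aut}(\widehat{B}_n)$$ be the kernel of the natural homomorphism $\mathfrak{p}_1$ to $\mathrm{Aut}(\widehat{\mathcal{B}}_n)$, $\mathfrak p_1(\alpha)(x\widehat C_n)=\alpha(x)\widehat C_n$, defined for the automorphisms $\alpha$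 with $\alpha(\widehat{C}_n)=\widehat{C}_n$; that is, $\ker(\mathfrak p_1)$ is the group of continuous automorphisms of $\widehat{B}_n$ that induce the identity on $\widehat{\mathcal{B}}_n$. Let $$Z_n=\ker\left(\widehat{\mathbb{Z}}^\times\to(\widehat{\mathbb{Z}}/n(n-1)\widehat{\mathbb{Z}})^\times\right).$$ Then: (1) every $\nu\in Z_n$ can be written as $\nu=1+n(n-1)e$ with a unique $e\in\widehat{\mathbb{Z}}$; (2) for every $\nu=1+n(n-1)e$ in $Z_n$ there is a unique $\phi_\nu\in\mathrm{Aut}(\widehat{B}_n)$ with $\phi_\nu(\sigma_i)=\sigma_i\zeta_n^e$ for all $i=1,\dots,n-1$; (3) the map $\nu\mapsto\phi_\nu$ is an isomorphism of groups $\phi: Z_n\to\ker(\mathfrak{p}_1)$. -/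

import Mathlib

/-! ### The ring of profinite integers -/

/-- The ring of profinite integers: the inverse limit of the rings `ℤ/mℤ` over `m ≥ 1` ordered by
divisibility, realized as the subring of compatible families in `∏ m, ℤ/mℤ`. -/
def ProfiniteInt : Subring (∀ m : ℕ+, ZMod (m : ℕ)) where
  carrier := {f | ∀ (m k : ℕ+) (h : (m : ℕ) ∣ (k : ℕ)), ZMod.castHom h (ZMod (m : ℕ)) (f k) = f m}
  mul_mem' hf hg m k h := by rw [Pi.mul_apply, map_mul, hf m k h, hg m k h, Pi.mul_apply]
  one_mem' m k h := by rw [Pi.one_apply, map_one, Pi.one_apply]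
  add_mem' hf hg m k h := by rw [Pi.add_apply, map_add, hf m k h, hg m k h, Pi.add_apply]
  zero_mem' m k h := by rw [Pi.zero_apply, map_zero, Pi.zero_apply]
  neg_mem' hf m k h := by rw [Pi.neg_apply, map_neg, hf m k h, Pi.neg_apply]

/-- The kernel of the reduction map from the units of `ProfiniteInt` to the units of
`ProfiniteInt / n (n - 1) ProfiniteInt`. -/
def congruenceUnits (n : ℕ) : Subgroup ProfiniteIntˣ :=
  (Units.map (Ideal.Quotient.mk
    (Ideal.span {((n * (n - 1) : ℕ) : ProfiniteInt)})).toMonoidHom).ker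

/-! ### Profinite completions and powers with profinite integer exponents -/

/-- The profinite completion of a group: the inverse limit of its finite quotients. -/
abbrev Completion (G : Type) [Group G] : ProfiniteGrp.{0} :=
  ProfiniteGrp.ProfiniteCompletion.completion (GrpCat.of G)

/-- The canonical homomorphism from a group to its profinite completion. -/
def toCompletion (G : Type) [Group G] : G →* Completion G :=
  (ProfiniteGrp.ProfiniteCompletion.eta (GrpCat.of G)).hom

/-- The power `y ^ e` in a finite quotient `G ⧸ H`, with exponent a profinite integer `e`: the
exponent is read off from the component of `e` in `ℤ/mℤ`, where `m` is the order of `G ⧸ H`. -/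
noncomputable def finitePow {G : Type*} [Group G] (H : Subgroup G) [H.Normal]
    [H.FiniteIndex] (y : G ⧸ H) (e : ProfiniteInt) : G ⧸ H :=
  y ^ (e.val ⟨H.index, Nat.pos_of_ne_zero Subgroup.FiniteIndex.index_ne_zero⟩).val

theorem map_finitePow {G : Type*} [Group G] (H K : Subgroup G) [H.Normal] [K.Normal]
    [H.FiniteIndex] [K.FiniteIndex] (hle : H ≤ K) (y : G ⧸ H) (e : ProfiniteInt) :
    QuotientGroup.map H K (MonoidHom.id G) hle (finitePow H y e) =
      finitePow K (QuotientGroup.map H K (MonoidHom.id G) hle y) e := by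
  have hdvd : K.index ∣ H.index := Subgroup.index_dvd_of_le hle
  have hK : 0 < K.index := Nat.pos_of_ne_zero Subgroup.FiniteIndex.index_ne_zero
  have hH : 0 < H.index := Nat.pos_of_ne_zero Subgroup.FiniteIndex.index_ne_zero
  unfold finitePow
  rw [map_pow, pow_eq_pow_iff_modEq]
  refine Nat.ModEq.of_dvd (orderOf_dvd_natCard _ : _ ∣ K.index) ?_
  have he := e.2 ⟨K.index, hK⟩ ⟨H.index, hH⟩ hdvd
  have nK : NeZero K.index := ⟨hK.ne'⟩
  have nH : NeZero H.index := ⟨hH.ne'⟩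
  have key : ∀ (a : ZMod H.index) (b : ZMod K.index),
      ZMod.castHom hdvd (ZMod K.index) a = b → a.val ≡ b.val [MOD K.index] := by
    rintro a b rfl
    rw [← ZMod.natCast_eq_natCast_iff, ZMod.natCast_zmod_val, ZMod.castHom_apply,
      ZMod.natCast_val]
  exact key _ _ he

/-- The power `x ^ e` of an element `x` of a profinite completion, with exponent a profinite
integer `e`: in a finite quotient `G ⧸ H` of order `m` it is the power of the component of `x` by
any natural number representing `e` modulo `m`. -/
noncomputable def profinitePow {G : Type} [Group G] (x : Completion G) (e : ProfiniteInt) : Completion G :=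
  ⟨fun H => finitePow H.toSubgroup (x.val H) e,
    fun H K π => (map_finitePow H.toSubgroup K.toSubgroup (CategoryTheory.leOfHom π)
      (x.val H) e).trans (congrArg (fun y => finitePow K.toSubgroup y e) (x.2 π))⟩

/-! ### Continuous automorphisms and their action on quotients -/

/-- The group of continuous automorphisms (with continuous inverse) of a topological group. -/
def ContAut (G : Type*) [Group G] [TopologicalSpace G] : Subgroup (MulAut G) where
  carrier := {α | Continuous α ∧ Continuous α.symm}
  mul_mem' ha hb := ⟨ha.1.comp hb.1, hb.2.comp ha.2⟩
  one_mem' := ⟨continuous_id, continuous_id⟩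
  inv_mem' ha := ⟨ha.2, ha.1⟩

/-- The subgroup of those automorphisms in `ContAut G` that map the subgroup `C` onto itself. -/
def ContAutPair {G : Type*} [Group G] [TopologicalSpace G] (C : Subgroup G) :
    Subgroup (ContAut G) where
  carrier := {α | C.map (α : MulAut G).toMonoidHom = C}
  mul_mem' {a b} ha hb := by
    have ha' : C.map (a : MulAut G).toMonoidHom = C := ha
    have hb' : C.map (b : MulAut G).toMonoidHom = C := hb
    change C.map ((a : MulAut G).toMonoidHom.comp (b : MulAut G).toMonoidHom) = C
    rw [← Subgroup.map_map, hb', ha']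
  one_mem' := Subgroup.map_id C
  inv_mem' {a} ha := by
    have ha' : C.map (a : MulAut G).toMonoidHom = C := ha
    exact (Subgroup.map_symm_eq_iff_map_eq (e := (a : MulAut G)) C).2 ha'

/-- The homomorphism from the automorphisms of `G` preserving a normal subgroup `C` to the
automorphisms of `G ⧸ C`, sending `α` to `x C ↦ α(x) C`. -/
def quotientAut {G : Type*} [Group G] [TopologicalSpace G] (C : Subgroup G) [C.Normal] :
    ContAutPair C →* ContAut (G ⧸ C) where
  toFun α := ⟨QuotientGroup.congr C C (α : ContAut G).1 α.2,
    (QuotientGroup.isQuotientMap_mk C).continuous_iff.2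
      (QuotientGroup.continuous_mk.comp (α : ContAut G).2.1),
    (QuotientGroup.isQuotientMap_mk C).continuous_iff.2
      (QuotientGroup.continuous_mk.comp (α : ContAut G).2.2)⟩
  map_one' := by
    apply Subtype.ext
    ext x
    induction x using QuotientGroup.induction_on
    rfl
  map_mul' a b := by
    apply Subtype.ext
    ext x
    induction x using QuotientGroup.induction_on
    rfl

/-- The kernel of the passage from automorphisms of `G` to automorphisms of `G ⧸ C`, as a subgroup
of the group of all continuous automorphisms of `G`. -/
def quotientAutKer {G : Type*} [Group G] [TopologicalSpace G] (C : Subgroup G) [C.Normal] :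
    Subgroup (ContAut G) :=
  (quotientAut C).ker.map (ContAutPair C).subtype

/-- A continuous automorphism lies in `quotientAutKer C` exactly when it induces the identity of
`G ⧸ C`; no condition is lost by first restricting to automorphisms that preserve `C`. -/
theorem mem_quotientAutKer_iff {G : Type*} [Group G] [TopologicalSpace G] (C : Subgroup G)
    [C.Normal] (α : ContAut G) :
    α ∈ quotientAutKer C ↔ ∀ x : G, ((α.1 x : G) : G ⧸ C) = (x : G ⧸ C) := by
  constructor
  · rintro ⟨β, hβ, rfl⟩ x
    have h : quotientAut C β = 1 := hβ
    exact DFunLike.congr_fun (congrArg Subtype.val h) (x : G ⧸ C)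
  · intro h
    have hmem : ∀ x : G, α.1 x ∈ C ↔ x ∈ C := fun x => by
      rw [← QuotientGroup.eq_one_iff, h x, QuotientGroup.eq_one_iff]
    have hα : α ∈ ContAutPair C := by
      change C.map (α : MulAut G).toMonoidHom = C
      ext y
      constructor
      · rintro ⟨x, hx, rfl⟩
        exact (hmem x).2 hx
      · intro hy
        refine ⟨α.1.symm y, (hmem _).1 ?_, α.1.apply_symm_apply y⟩
        rwa [α.1.apply_symm_apply y]
    refine ⟨⟨α, hα⟩, ?_, rfl⟩
    change quotientAut C ⟨α, hα⟩ = 1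
    apply Subtype.ext
    ext x
    induction x using QuotientGroup.induction_on with
    | H z => exact h z

/-! ### Braid groups -/

/-- The braid relations among the generators `σ_1, …, σ_{n-1}`, indexed by `Fin (n - 1)`. -/
def braidRels (n : ℕ) : Set (FreeGroup (Fin (n - 1))) :=
  {r | ∃ i j : Fin (n - 1), (i : ℕ) + 1 = j ∧
      r = (.of i * .of j * .of i) * (.of j * .of i * .of j)⁻¹} ∪
  {r | ∃ i j : Fin (n - 1), (i : ℕ) + 2 ≤ j ∧
      r = (.of i * .of j) * (.of j * .of i)⁻¹}

/-- The Artin braid group `B_n` with `n` strings. -/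
abbrev BraidGroup (n : ℕ) : Type := PresentedGroup (braidRels n)

/-- The profinite braid group: the profinite completion of `B_n`. -/
abbrev ProfiniteBraidGroup (n : ℕ) : ProfiniteGrp.{0} := Completion (BraidGroup n)

/-- The image of the generator `σ_i` in the profinite braid group. -/
def sigma (n : ℕ) (i : Fin (n - 1)) : ProfiniteBraidGroup n :=
  toCompletion (BraidGroup n) (PresentedGroup.of i)

/-- The element `ζ_n = (σ_1 σ_2 ⋯ σ_{n-1}) ^ n` of the profinite braid group. -/
def zeta (n : ℕ) : ProfiniteBraidGroup n := (List.ofFn (sigma n)).prod ^ n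

/-- The product `s 0 * s 1 * ⋯ * s (k - 1)`. -/
def partProd {G : Type*} [Group G] (s : ℕ → G) : ℕ → G
  | 0 => 1
  | k + 1 => partProd s k * s k

theorem commute_partProd {G : Type*} [Group G] {s : ℕ → G} {m : ℕ}
    (hc : ∀ i j, i + 2 ≤ j → j < m → s i * s j = s j * s i) {j : ℕ} (hj : j < m) :
    ∀ k, k + 1 ≤ j → partProd s k * s j = s j * partProd s k
  | 0, _ => by simp [partProd]
  | k + 1, h => by
    rw [partProd, mul_assoc, hc k j (by omega) hj, ← mul_assoc,
      commute_partProd hc hj k (by omega), mul_assoc]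

theorem partProd_shift {G : Type*} [Group G] {s : ℕ → G} {m : ℕ}
    (hb : ∀ i, i + 1 < m → s i * s (i + 1) * s i = s (i + 1) * s i * s (i + 1))
    (hc : ∀ i j, i + 2 ≤ j → j < m → s i * s j = s j * s i) (i : ℕ) :
    ∀ d, i + 2 + d ≤ m →
      partProd s (i + 2 + d) * s i = s (i + 1) * partProd s (i + 2 + d)
  | 0, h => by
    have h1 := commute_partProd hc (j := i + 1) (by omega) i le_rfl
    have h2 := hb i (by omega)
    calc partProd s i * s i * s (i + 1) * s i
        = partProd s i * (s i * s (i + 1) * s i) := by simp only [mul_assoc]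
      _ = (partProd s i * s (i + 1)) * s i * s (i + 1) := by rw [h2]; simp only [mul_assoc]
      _ = s (i + 1) * (partProd s i * s i * s (i + 1)) := by rw [h1]; simp only [mul_assoc]
  | d + 1, h => by
    have ih := partProd_shift hb hc i d (by omega)
    change partProd s (i + 2 + d) * s (i + 2 + d) * s i =
      s (i + 1) * (partProd s (i + 2 + d) * s (i + 2 + d))
    rw [mul_assoc, ← hc i (i + 2 + d) (by omega) (by omega), ← mul_assoc, ih, mul_assoc]

theorem partProd_mul_partProd {G : Type*} [Group G] {s : ℕ → G} {m : ℕ}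
    (hb : ∀ i, i + 1 < m → s i * s (i + 1) * s i = s (i + 1) * s i * s (i + 1))
    (hc : ∀ i j, i + 2 ≤ j → j < m → s i * s j = s j * s i) :
    ∀ k, k + 1 ≤ m → s 0 * (partProd s m * partProd s k) = partProd s (k + 1) * partProd s m
  | 0, _ => by simp [partProd]
  | k + 1, h => by
    obtain ⟨d, rfl⟩ : ∃ d, m = k + 2 + d := ⟨m - (k + 2), by omega⟩
    have hs := partProd_shift hb hc k d le_rfl
    have ih := partProd_mul_partProd hb hc k (by omega)
    calc s 0 * (partProd s (k + 2 + d) * (partProd s k * s k))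
        = (s 0 * (partProd s (k + 2 + d) * partProd s k)) * s k := by simp only [mul_assoc]
      _ = partProd s (k + 1) * (partProd s (k + 2 + d) * s k) := by rw [ih, mul_assoc]
      _ = partProd s (k + 1) * s (k + 1) * partProd s (k + 2 + d) := by rw [hs, mul_assoc]

theorem partProd_pow_commute {G : Type*} [Group G] {s : ℕ → G} {m : ℕ}
    (hb : ∀ i, i + 1 < m → s i * s (i + 1) * s i = s (i + 1) * s i * s (i + 1))
    (hc : ∀ i j, i + 2 ≤ j → j < m → s i * s j = s j * s i) (i : ℕ) (hi : i < m) :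
    Commute (partProd s m ^ (m + 1)) (s i) := by
  have hshift : ∀ i, i + 1 < m → partProd s m * s i = s (i + 1) * partProd s m := by
    intro i hi
    obtain ⟨d, rfl⟩ : ∃ d, m = i + 2 + d := ⟨m - (i + 2), by omega⟩
    exact partProd_shift hb hc i d le_rfl
  have hpow : ∀ k, k < m → partProd s m ^ k * s 0 = s k * partProd s m ^ k := by
    intro k
    induction k with
    | zero => intro _; simp
    | succ k ih =>
      intro hk
      rw [pow_succ', mul_assoc, ih (by omega), ← mul_assoc, hshift k hk, mul_assoc]
  have h0 : Commute (partProd s m ^ (m + 1)) (s 0) := by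
    obtain ⟨k, rfl⟩ : ∃ k, m = k + 1 := ⟨m - 1, by omega⟩
    have h1 := partProd_mul_partProd hb hc k le_rfl
    have h2 : partProd s (k + 1) * partProd s (k + 1) * s k =
        s 0 * (partProd s (k + 1) * partProd s (k + 1)) := by
      refine (congrArg (· * s k) h1.symm).trans ?_
      change s 0 * (partProd s (k + 1) * partProd s k) * s k =
        s 0 * (partProd s (k + 1) * (partProd s k * s k))
      simp only [mul_assoc]
    change partProd s (k + 1) ^ (k + 1 + 1) * s 0 = s 0 * partProd s (k + 1) ^ (k + 1 + 1)
    have h3 : partProd s (k + 1) ^ (k + 1 + 1) =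
        partProd s (k + 1) * partProd s (k + 1) * partProd s (k + 1) ^ k := by
      rw [pow_succ', pow_succ', mul_assoc]
    rw [h3, mul_assoc, hpow k (by omega), ← mul_assoc, h2, mul_assoc]
  have hi' : s i = partProd s m ^ i * s 0 * (partProd s m ^ i)⁻¹ := by
    rw [hpow i hi, mul_inv_cancel_right]
  have hp : Commute (partProd s m ^ (m + 1)) (partProd s m ^ i) :=
    (Commute.refl _).pow_pow _ _
  rw [hi']
  exact (hp.mul_right h0).mul_right hp.inv_right

theorem partProd_eq_prod_ofFn {G : Type*} [Group G] (s : ℕ → G) :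
    ∀ m, (List.ofFn fun i : Fin m => s i).prod = partProd s m
  | 0 => by simp [partProd]
  | m + 1 => by
    rw [List.ofFn_succ', List.concat_eq_append, List.prod_append, List.prod_singleton]
    exact congrArg (· * s m) (partProd_eq_prod_ofFn s m)

theorem sigma_braid (n : ℕ) (i j : Fin (n - 1)) (h : (i : ℕ) + 1 = j) :
    sigma n i * sigma n j * sigma n i = sigma n j * sigma n i * sigma n j := by
  have := PresentedGroup.one_of_mem (rels := braidRels n) (Or.inl ⟨i, j, h, rfl⟩)
  rw [map_mul, map_inv, mul_inv_eq_one, map_mul, map_mul, map_mul, map_mul] at this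
  have h2 := congrArg (toCompletion (BraidGroup n)) this
  rw [map_mul, map_mul, map_mul, map_mul] at h2
  exact h2

theorem sigma_comm (n : ℕ) (i j : Fin (n - 1)) (h : (i : ℕ) + 2 ≤ j) :
    sigma n i * sigma n j = sigma n j * sigma n i := by
  have := PresentedGroup.one_of_mem (rels := braidRels n) (Or.inr ⟨i, j, h, rfl⟩)
  rw [map_mul, map_inv, mul_inv_eq_one, map_mul, map_mul] at this
  have h2 := congrArg (toCompletion (BraidGroup n)) this
  rw [map_mul, map_mul] at h2
  exact h2

theorem zeta_commute_sigma (n : ℕ) (i : Fin (n - 1)) : Commute (zeta n) (sigma n i) := by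
  let s : ℕ → ProfiniteBraidGroup n := fun k => if h : k < n - 1 then sigma n ⟨k, h⟩ else 1
  have hs : ∀ k : Fin (n - 1), s k = sigma n k := fun k => dif_pos k.2
  have hi := i.2
  have hz : zeta n = partProd s (n - 1) ^ (n - 1 + 1) := by
    rw [← partProd_eq_prod_ofFn, zeta, show n - 1 + 1 = n by omega]
    simp only [hs]
  rw [hz, ← hs i]
  refine partProd_pow_commute (fun a ha => ?_) (fun a b hab hb => ?_) i i.2
  · have := sigma_braid n ⟨a, by omega⟩ ⟨a + 1, ha⟩ rfl
    rwa [← hs, ← hs] at this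
  · have := sigma_comm n ⟨a, by omega⟩ ⟨b, hb⟩ hab
    rwa [← hs, ← hs] at this

theorem zeta_mem_center (n : ℕ) : zeta n ∈ Subgroup.center (ProfiniteBraidGroup n) := by
  have h1 : ∀ g : BraidGroup n, Commute (zeta n) (toCompletion (BraidGroup n) g) := by
    intro g
    have hg : g ∈ Subgroup.closure (Set.range (PresentedGroup.of (rels := braidRels n))) := by
      rw [PresentedGroup.closure_range_of]
      trivial
    induction hg using Subgroup.closure_induction with
    | mem x hx =>
      obtain ⟨i, rfl⟩ := hx
      exact zeta_commute_sigma n i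
    | one => rw [map_one]; exact Commute.one_right _
    | mul x y _ _ hx hy => rw [map_mul]; exact hx.mul_right hy
    | inv x _ hx => rw [map_inv]; exact hx.inv_right
  have hd : DenseRange (toCompletion (BraidGroup n)) :=
    ProfiniteGrp.ProfiniteCompletion.denseRange (GrpCat.of (BraidGroup n))
  rw [Subgroup.mem_center_iff]
  have h2 : (fun x : ProfiniteBraidGroup n => x * zeta n) = fun x => zeta n * x :=
    hd.equalizer (continuous_id.mul continuous_const) (continuous_const.mul continuous_id)
      (funext fun g => (h1 g).eq.symm)
  exact fun g => congrFun h2 g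

/-- The closed subgroup of the profinite braid group topologically generated by `ζ_n`. -/
def zetaClosure (n : ℕ) : Subgroup (ProfiniteBraidGroup n) :=
  (Subgroup.zpowers (zeta n)).topologicalClosure

theorem zetaClosure_le_center (n : ℕ) :
    zetaClosure n ≤ Subgroup.center (ProfiniteBraidGroup n) := by
  refine Subgroup.topologicalClosure_minimal _ ?_ ?_
  · rw [Subgroup.zpowers_le]
    exact zeta_mem_center n
  · rw [Subgroup.coe_center, ← Set.centralizer_univ]
    exact Set.isClosed_centralizer _

instance zetaClosure_normal (n : ℕ) : (zetaClosure n).Normal where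
  conj_mem c hc g := by
    rw [Subgroup.mem_center_iff.1 (zetaClosure_le_center n hc) g, mul_inv_cancel_right]
    exact hc

/-! ### Profinite integers -/

namespace ProfiniteInt

/-! Write N = n(n-1). Since ζ is central and both sides of each braid relation have the same length,
multiplying every generator by the same ζ^e respects the relations and defines an endomorphism f_e
(`exists_hom`). As ζ is a word of length N in the generators, f_e(ζ) = ζ^(1+Ne)
(`map_zeta_of_map_sigma`). Hence f_e ∘ f_e' = f_e'' with 1 + Ne'' = (1+Ne)(1+Ne'): composition
becomes multiplication of the numbers 1 + Ne, and f_e is invertible when 1 + Ne is a unit.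

Conversely, an automorphism trivial modulo the closure of ⟨ζ⟩ multiplies each σ_i by some ζ^(e_i),
and the braid relations force all e_i to agree (`exists_map_sigma`). The inverse automorphism has
the same form, so 1 + Ne is a unit. Comparing exponents requires e ↦ ζ^e to be injective
(`profinitePow_zeta_injective`). This follows from the exponent sum, which sends ζ^e to Ne, because
N is not a zero divisor in the profinite integers. -/

theorem natCast_apply (k : ℕ) (m : ℕ+) : (k : ProfiniteInt).val m = (k : ZMod m) := by
  rw [Subring.coe_natCast, Pi.natCast_apply]

instance compactSpace : CompactSpace ProfiniteInt := by
  have hfin : ∀ m : ℕ+, CompactSpace (ZMod (m : ℕ)) := fun m => Finite.compactSpace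
  refine isCompact_iff_compactSpace.1 (IsClosed.isCompact ?_)
  change IsClosed {f : ∀ m : ℕ+, ZMod (m : ℕ) | ∀ (m k : ℕ+) (h : (m : ℕ) ∣ (k : ℕ)),
    ZMod.castHom h (ZMod (m : ℕ)) (f k) = f m}
  simp only [Set.ofPred_forall]
  exact isClosed_iInter fun m => isClosed_iInter fun k => isClosed_iInter fun h =>
    isClosed_eq (continuous_of_discreteTopology.comp (continuous_apply k)) (continuous_apply m)

/-- A basic open set constrains finitely many components, and all their moduli divide the product M,
so a natural number representing `e` modulo M satisfies every constraint. Identities continuous in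
the exponent thus reduce to natural exponents. -/
theorem denseRange_natCast : DenseRange (Nat.cast : ℕ → ProfiniteInt) := by
  refine dense_iff_inter_open.2 ?_
  rintro U ⟨s, hs, rfl⟩ ⟨e, he⟩
  obtain ⟨J, V, hV, hJ⟩ := isOpen_pi_iff.1 hs e.1 he
  let M : ℕ+ := ∏ j ∈ J, j
  have hk : ∀ j ∈ J, ((e.1 M).val : ZMod j) = e.1 j := fun j hj => by
    have hdvd : (j : ℕ) ∣ (M : ℕ) := PNat.dvd_iff.1 (Finset.dvd_prod_of_mem _ hj)
    rw [← e.2 j M hdvd, ZMod.castHom_apply, ZMod.natCast_val]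
  refine ⟨((e.1 M).val : ProfiniteInt), hJ fun j hj => ?_, Set.mem_range_self _⟩
  rw [natCast_apply, hk j hj]
  exact (hV j hj).2

/-- The component modulo m is determined by the one modulo km, where km ∣ ka gives m ∣ a. -/
theorem natCast_mul_eq_zero {k : ℕ} (hk : 0 < k) {e : ProfiniteInt}
    (h : (k : ProfiniteInt) * e = 0) : e = 0 := by
  apply Subtype.ext
  funext m
  let K : ℕ+ := ⟨k, hk⟩ * m
  have hmK : (m : ℕ) ∣ (K : ℕ) := ⟨k, mul_comm k m⟩
  have h1 : (k : ZMod K) * e.1 K = 0 := by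
    rw [← natCast_apply k K]
    exact congrFun (congrArg Subtype.val h) K
  rw [← ZMod.natCast_zmod_val (e.1 K), ← Nat.cast_mul, ZMod.natCast_eq_zero_iff] at h1
  rw [← e.2 m K hmK, ← ZMod.natCast_zmod_val (e.1 K), map_natCast]
  exact (ZMod.natCast_eq_zero_iff _ _).2 (Nat.dvd_of_mul_dvd_mul_left hk h1)

end ProfiniteInt

theorem mem_congruenceUnits_iff {n : ℕ} {ν : ProfiniteIntˣ} :
    ν ∈ congruenceUnits n ↔
      ∃ e : ProfiniteInt, (ν : ProfiniteInt) = 1 + ((n * (n - 1) : ℕ) : ProfiniteInt) * e := by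
  rw [congruenceUnits, MonoidHom.mem_ker, Units.ext_iff]
  change Ideal.Quotient.mk _ (ν : ProfiniteInt) = Ideal.Quotient.mk _ 1 ↔ _
  rw [Ideal.Quotient.mk_eq_mk_iff_sub_mem, Ideal.mem_span_singleton']
  refine exists_congr fun e => ?_
  rw [eq_sub_iff_add_eq, eq_comm, add_comm, mul_comm]

/-! ### Powers with profinite integer exponents -/

section ProfinitePow

variable {G : Type} [Group G]

theorem finitePow_natCast (H : Subgroup G) [H.Normal] [H.FiniteIndex] (y : G ⧸ H) (k : ℕ) :
    finitePow H y (k : ProfiniteInt) = y ^ k := by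
  have hm : 0 < H.index := Nat.pos_of_ne_zero Subgroup.FiniteIndex.index_ne_zero
  have hk : ((k : ProfiniteInt).val ⟨H.index, hm⟩).val = k % H.index :=
    (congrArg ZMod.val (ProfiniteInt.natCast_apply k ⟨H.index, hm⟩)).trans (ZMod.val_natCast _ _)
  refine (congrArg (y ^ ·) hk).trans ?_
  rw [pow_eq_pow_iff_modEq]
  exact (Nat.mod_modEq _ _).of_dvd (orderOf_dvd_natCard _)

theorem profinitePow_natCast (x : Completion G) (k : ℕ) :
    profinitePow x (k : ProfiniteInt) = x ^ k := by
  apply Subtype.ext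
  funext H
  exact finitePow_natCast H.toSubgroup (x.val H) k

/-- In each finite quotient the power depends on a single component of the exponent, which lives in
a discrete ring. -/
theorem continuous_profinitePow (x : Completion G) : Continuous (profinitePow x) := by
  refine Continuous.subtype_mk (continuous_pi fun H => ?_) _
  have hm : 0 < H.toSubgroup.index := Nat.pos_of_ne_zero Subgroup.FiniteIndex.index_ne_zero
  let p : ZMod (⟨H.toSubgroup.index, hm⟩ : ℕ+) →
      (ProfiniteGrp.ProfiniteCompletion.diagram (GrpCat.of G)).obj H :=
    fun a => (x.val H : G ⧸ H.toSubgroup) ^ a.val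
  exact (continuous_of_discreteTopology (f := p)).comp
    ((continuous_apply _).comp continuous_subtype_val)

theorem profinitePow_one (x : Completion G) : profinitePow x 1 = x := by
  rw [← Nat.cast_one, profinitePow_natCast, pow_one]

theorem profinitePow_zero (x : Completion G) : profinitePow x 0 = 1 := by
  rw [← Nat.cast_zero, profinitePow_natCast, pow_zero]

theorem profinitePow_add (x : Completion G) (e f : ProfiniteInt) :
    profinitePow x (e + f) = profinitePow x e * profinitePow x f := by
  have hx := continuous_profinitePow x
  refine ProfiniteInt.denseRange_natCast.induction_on₂ (p := fun e f => profinitePow x (e + f) =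
    profinitePow x e * profinitePow x f) (isClosed_eq (by fun_prop) (by fun_prop)) ?_ e f
  intro k l
  rw [← Nat.cast_add]
  simp only [profinitePow_natCast, pow_add]

theorem profinitePow_natCast_mul (x : Completion G) (k : ℕ) (e : ProfiniteInt) :
    profinitePow x (k * e) = profinitePow x e ^ k := by
  induction k with
  | zero => rw [Nat.cast_zero, zero_mul, profinitePow_zero, pow_zero]
  | succ k ih => rw [Nat.cast_succ, add_mul, one_mul, profinitePow_add, ih, pow_succ]

theorem profinitePow_mul (x : Completion G) (e f : ProfiniteInt) :
    profinitePow x (e * f) = profinitePow (profinitePow x e) f := by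
  have hx := continuous_profinitePow x
  have hxe := continuous_profinitePow (profinitePow x e)
  refine ProfiniteInt.denseRange_natCast.induction_on (p := fun f => profinitePow x (e * f) =
    profinitePow (profinitePow x e) f) f (isClosed_eq (by fun_prop) (by fun_prop)) fun k => ?_
  rw [mul_comm, profinitePow_natCast_mul, profinitePow_natCast]

theorem map_profinitePow {H : Type} [Group H] (f : Completion G →* Completion H)
    (hf : Continuous f) (x : Completion G) (e : ProfiniteInt) :
    f (profinitePow x e) = profinitePow (f x) e := by
  have hx := continuous_profinitePow x
  have hfx := continuous_profinitePow (f x)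
  refine ProfiniteInt.denseRange_natCast.induction_on (p := fun e => f (profinitePow x e) =
    profinitePow (f x) e) e (isClosed_eq (by fun_prop) (by fun_prop)) fun k => ?_
  rw [profinitePow_natCast, profinitePow_natCast, map_pow]

/-- The range is a subgroup, and it is closed because the profinite integers are compact; density of
the natural numbers gives the other inclusion. -/
theorem topologicalClosure_zpowers_eq_range_profinitePow (x : Completion G) :
    ((Subgroup.zpowers x).topologicalClosure : Set (Completion G)) =
      Set.range (profinitePow x) := by
  have hx := continuous_profinitePow x
  apply subset_antisymm
  · let S : Subgroup (Completion G) :=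
      { carrier := Set.range (profinitePow x)
        one_mem' := ⟨0, profinitePow_zero x⟩
        mul_mem' := by
          rintro _ _ ⟨e, rfl⟩ ⟨f, rfl⟩
          exact ⟨e + f, profinitePow_add x e f⟩
        inv_mem' := by
          rintro _ ⟨e, rfl⟩
          refine ⟨-e, eq_inv_of_mul_eq_one_left ?_⟩
          rw [← profinitePow_add, neg_add_cancel, profinitePow_zero] }
    refine Subgroup.topologicalClosure_minimal _ (t := S) ?_ (isCompact_range hx).isClosed
    exact Subgroup.zpowers_le.2 ⟨1, profinitePow_one x⟩
  · refine (hx.range_subset_closure_image_dense ProfiniteInt.denseRange_natCast).trans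
      (closure_mono ?_)
    rintro _ ⟨_, ⟨k, rfl⟩, rfl⟩
    rw [profinitePow_natCast]
    exact pow_mem (Subgroup.mem_zpowers x) k

end ProfinitePow

/-! ### Homomorphisms out of profinite braid groups -/

/-- The continuous extension to the profinite completion of a homomorphism to a profinite group. -/
theorem exists_completion_lift {G : Type} [Group G] {P : ProfiniteGrp.{0}} (f : G →* P) :
    ∃ F : Completion G →* P, Continuous F ∧ ∀ g, F (toCompletion G g) = f g := by
  let F := ProfiniteGrp.ProfiniteCompletion.lift (P := P) (GrpCat.ofHom f)
  refine ⟨F.hom.toMonoidHom, F.hom.continuous_toFun, fun g => ?_⟩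
  exact CategoryTheory.ConcreteCategory.congr_hom
    (ProfiniteGrp.ProfiniteCompletion.lift_eta (P := P) (GrpCat.ofHom f)) g

namespace ProfiniteBraidGroup

variable {n : ℕ}

theorem hom_ext {M : Type*} [Group M] [TopologicalSpace M] [T2Space M]
    {f g : ProfiniteBraidGroup n →* M} (hf : Continuous f) (hg : Continuous g)
    (h : ∀ i, f (sigma n i) = g (sigma n i)) : f = g := by
  have hd : DenseRange (toCompletion (BraidGroup n)) :=
    ProfiniteGrp.ProfiniteCompletion.denseRange (GrpCat.of (BraidGroup n))
  have hfg : f.comp (toCompletion _) = g.comp (toCompletion _) := PresentedGroup.ext h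
  exact DFunLike.coe_injective (hd.equalizer hf hg (funext fun x => DFunLike.congr_fun hfg x))

theorem exists_lift {P : ProfiniteGrp.{0}} (s : Fin (n - 1) → P)
    (hb : ∀ i j : Fin (n - 1), (i : ℕ) + 1 = j → s i * s j * s i = s j * s i * s j)
    (hc : ∀ i j : Fin (n - 1), (i : ℕ) + 2 ≤ j → s i * s j = s j * s i) :
    ∃ F : ProfiniteBraidGroup n →* P, Continuous F ∧ ∀ i, F (sigma n i) = s i := by
  have hrel : ∀ r ∈ braidRels n, FreeGroup.lift s r = 1 := by
    rintro _ (⟨i, j, h, rfl⟩ | ⟨i, j, h, rfl⟩)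
    · simp only [map_mul, map_inv, FreeGroup.lift_apply_of, mul_inv_eq_one]
      exact hb i j h
    · simp only [map_mul, map_inv, FreeGroup.lift_apply_of, mul_inv_eq_one]
      exact hc i j h
  obtain ⟨F, hF, h⟩ := exists_completion_lift (PresentedGroup.toGroup hrel)
  exact ⟨F, hF, fun i => (h _).trans (PresentedGroup.toGroup.of hrel)⟩

theorem map_zeta {M : Type*} [Group M] (f : ProfiniteBraidGroup n →* M) :
    f (zeta n) = (List.ofFn fun i => f (sigma n i)).prod ^ n := by
  rw [zeta, map_pow, map_list_prod, List.map_ofFn]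
  rfl

theorem commute_profinitePow_zeta (x : ProfiniteBraidGroup n) (e : ProfiniteInt) :
    Commute x (profinitePow (zeta n) e) := by
  refine Subgroup.mem_center_iff.1 (zetaClosure_le_center n ?_) x
  rw [zetaClosure, ← SetLike.mem_coe, topologicalClosure_zpowers_eq_range_profinitePow]
  exact Set.mem_range_self e

theorem mul_zeta_pow_mul_mul_zeta_pow (x y : ProfiniteBraidGroup n) (a b : ProfiniteInt) :
    x * profinitePow (zeta n) a * (y * profinitePow (zeta n) b) =
      x * y * profinitePow (zeta n) (a + b) := by
  rw [profinitePow_add, (commute_profinitePow_zeta y a).symm.mul_mul_mul_comm]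

theorem prod_ofFn_mul_of_commute {M : Type*} [Monoid M] {z : M} (hz : ∀ x, Commute x z) :
    ∀ {m : ℕ} (s : Fin m → M), (List.ofFn fun i => s i * z).prod = (List.ofFn s).prod * z ^ m
  | 0, _ => by simp
  | m + 1, s => by
    rw [List.ofFn_succ, List.ofFn_succ, List.prod_cons, List.prod_cons,
      prod_ofFn_mul_of_commute hz, pow_succ', mul_assoc, ← mul_assoc z, ← (hz _).eq]
    simp only [mul_assoc]

/-- A homomorphism multiplying each generator by `ζ ^ e` raises `ζ` to the power
`1 + n (n - 1) e`. -/
theorem map_zeta_of_map_sigma {f : ProfiniteBraidGroup n →* ProfiniteBraidGroup n}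
    {e : ProfiniteInt} (h : ∀ i, f (sigma n i) = sigma n i * profinitePow (zeta n) e) :
    f (zeta n) = profinitePow (zeta n) (1 + ((n * (n - 1) : ℕ) : ProfiniteInt) * e) := by
  rw [map_zeta]
  simp only [h]
  -- The product of n - 1 generators gains ζ^((n-1)e), and its n-th power gains ζ^(n(n-1)e).
  rw [prod_ofFn_mul_of_commute (fun x => commute_profinitePow_zeta x e),
    ((commute_profinitePow_zeta _ e).pow_right _).mul_pow, ← pow_mul, profinitePow_add,
    profinitePow_one, profinitePow_natCast_mul, mul_comm n]
  rfl

/-- Composition of homomorphisms multiplying the generators by powers of `ζ`. -/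
theorem comp_map_sigma {f g : ProfiniteBraidGroup n →* ProfiniteBraidGroup n}
    (hf : Continuous f) {e e' : ProfiniteInt}
    (h : ∀ i, f (sigma n i) = sigma n i * profinitePow (zeta n) e)
    (h' : ∀ i, g (sigma n i) = sigma n i * profinitePow (zeta n) e') (i : Fin (n - 1)) :
    f (g (sigma n i)) = sigma n i *
      profinitePow (zeta n) (e + (1 + ((n * (n - 1) : ℕ) : ProfiniteInt) * e) * e') := by
  rw [h', map_mul, map_profinitePow f hf, h, map_zeta_of_map_sigma h, ← profinitePow_mul,
    profinitePow_add, mul_assoc]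

theorem exists_hom (e : ProfiniteInt) :
    ∃ f : ProfiniteBraidGroup n →* ProfiniteBraidGroup n, Continuous f ∧
      ∀ i, f (sigma n i) = sigma n i * profinitePow (zeta n) e := by
  refine exists_lift _ (fun i j hij => ?_) fun i j hij => ?_
  · simp only [mul_zeta_pow_mul_mul_zeta_pow, sigma_braid n i j hij]
  · simp only [mul_zeta_pow_mul_mul_zeta_pow, sigma_comm n i j hij]

/-- The exponent sum modulo `m`. -/
theorem exists_exponentSum (n : ℕ) (m : ℕ+) :
    ∃ f : ProfiniteBraidGroup n →* Multiplicative (ZMod m),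
      Continuous f ∧ ∀ i, f (sigma n i) = Multiplicative.ofAdd 1 :=
  exists_lift (P := ProfiniteGrp.of (Multiplicative (ZMod m)))
    (fun _ => Multiplicative.ofAdd (1 : ZMod m)) (fun _ _ _ => rfl) (fun _ _ _ => rfl)

theorem profinitePow_zeta_injective (hn : 2 ≤ n) :
    Function.Injective (profinitePow (zeta n)) := by
  have hpos : 0 < n * (n - 1) := Nat.mul_pos (by omega) (by omega)
  intro a b hab
  rw [← sub_eq_zero]
  refine ProfiniteInt.natCast_mul_eq_zero hpos ?_
  -- Any exponent sum modulo m sends ζ to n(n-1); density extends this from natural powers to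
  -- profinite ones.
  have hval : ∀ (m : ℕ+) (f : ProfiniteBraidGroup n →* Multiplicative (ZMod m)), Continuous f →
      (∀ i, f (sigma n i) = Multiplicative.ofAdd 1) → ∀ e : ProfiniteInt,
      f (profinitePow (zeta n) e) =
        Multiplicative.ofAdd (((n * (n - 1) : ℕ) * e : ProfiniteInt).1 m) := by
    intro m f hf hs e
    have hz := continuous_profinitePow (zeta n)
    have hev : Continuous fun e : ProfiniteInt => ((n * (n - 1) : ℕ) * e : ProfiniteInt).1 m :=
      (continuous_apply m).comp (continuous_subtype_val.comp (by fun_prop))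
    refine ProfiniteInt.denseRange_natCast.induction_on (p := fun e =>
      f (profinitePow (zeta n) e) =
        Multiplicative.ofAdd (((n * (n - 1) : ℕ) * e : ProfiniteInt).1 m)) e
      (isClosed_eq (hf.comp hz) (continuous_ofAdd.comp hev)) fun k => ?_
    rw [profinitePow_natCast, map_pow, map_zeta, ← Nat.cast_mul, ProfiniteInt.natCast_apply]
    simp only [hs]
    rw [List.ofFn_const, List.prod_replicate, ← pow_mul, ← pow_mul, ← ofAdd_nsmul, nsmul_one,
      ← mul_assoc, Nat.mul_comm (n - 1) n]
  apply Subtype.ext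
  funext m
  obtain ⟨f, hf, hs⟩ := exists_exponentSum n m
  have h := (hval m f hf hs a).symm.trans ((congrArg f hab).trans (hval m f hf hs b))
  rw [mul_sub]
  exact sub_eq_zero.2 (Multiplicative.ofAdd.injective h)

end ProfiniteBraidGroup

/-! ### Automorphisms inducing the identity modulo the closed subgroup generated by `ζ` -/

namespace ProfiniteBraidGroup

variable {n : ℕ}

theorem contAut_ext {α β : ContAut (ProfiniteBraidGroup n)}
    (h : ∀ i, (α : MulAut (ProfiniteBraidGroup n)) (sigma n i) =
      (β : MulAut (ProfiniteBraidGroup n)) (sigma n i)) : α = β := by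
  have := hom_ext (f := (α : MulAut (ProfiniteBraidGroup n)).toMonoidHom)
    (g := (β : MulAut (ProfiniteBraidGroup n)).toMonoidHom) α.2.1 β.2.1 h
  exact Subtype.ext (MulEquiv.ext fun x => DFunLike.congr_fun this x)

theorem exists_contAut {e e' : ProfiniteInt}
    (h : e + (1 + ((n * (n - 1) : ℕ) : ProfiniteInt) * e) * e' = 0) :
    ∃ α : ContAut (ProfiniteBraidGroup n), ∀ i,
      (α : MulAut (ProfiniteBraidGroup n)) (sigma n i) =
        sigma n i * profinitePow (zeta n) e := by
  obtain ⟨f, hf, hfs⟩ := exists_hom (n := n) e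
  obtain ⟨g, hg, hgs⟩ := exists_hom (n := n) e'
  -- The hypothesis reads e + e' + n(n-1)ee' = 0, which is symmetric in e and e'.
  have h' : e' + (1 + ((n * (n - 1) : ℕ) : ProfiniteInt) * e') * e = 0 := by
    rw [← h]
    ring
  have hfg : f.comp g = MonoidHom.id _ := hom_ext (hf.comp hg) continuous_id fun i => by
    rw [MonoidHom.comp_apply, comp_map_sigma hf hfs hgs, h, profinitePow_zero, mul_one]
    rfl
  have hgf : g.comp f = MonoidHom.id _ := hom_ext (hg.comp hf) continuous_id fun i => by
    rw [MonoidHom.comp_apply, comp_map_sigma hg hgs hfs, h', profinitePow_zero, mul_one]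
    rfl
  exact ⟨⟨f.toMulEquiv g hgf hfg, hf, hg⟩, hfs⟩

theorem exists_contAut_of_unit (hn : 2 ≤ n) {ν : ProfiniteIntˣ} {e : ProfiniteInt}
    (he : (ν : ProfiniteInt) = 1 + ((n * (n - 1) : ℕ) : ProfiniteInt) * e) :
    ∃ α : ContAut (ProfiniteBraidGroup n), ∀ i,
      (α : MulAut (ProfiniteBraidGroup n)) (sigma n i) =
        sigma n i * profinitePow (zeta n) e := by
  have hν : ν ∈ congruenceUnits n := mem_congruenceUnits_iff.2 ⟨e, he⟩
  -- The inverse unit is again 1 modulo n(n-1), so it supplies the exponent of the inverse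
  -- automorphism.
  obtain ⟨e', he'⟩ := mem_congruenceUnits_iff.1 (inv_mem hν)
  refine exists_contAut (e' := e') (ProfiniteInt.natCast_mul_eq_zero
    (Nat.mul_pos (by omega) (by omega) : 0 < n * (n - 1)) ?_)
  have h := ν.mul_inv
  rw [he, he'] at h
  linear_combination h

theorem mem_quotientAutKer_of_map_sigma {α : ContAut (ProfiniteBraidGroup n)} {e : ProfiniteInt}
    (h : ∀ i, (α : MulAut (ProfiniteBraidGroup n)) (sigma n i) =
      sigma n i * profinitePow (zeta n) e) : α ∈ quotientAutKer (zetaClosure n) := by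
  rw [mem_quotientAutKer_iff]
  -- Closedness makes the quotient Hausdorff, so maps into it may be compared on generators.
  have hcl : IsClosed (zetaClosure n : Set (ProfiniteBraidGroup n)) :=
    Subgroup.isClosed_topologicalClosure _
  have heq := hom_ext
    (f := (QuotientGroup.mk' (zetaClosure n)).comp
      (α : MulAut (ProfiniteBraidGroup n)).toMonoidHom)
    (g := QuotientGroup.mk' (zetaClosure n))
    (QuotientGroup.continuous_mk.comp α.2.1) QuotientGroup.continuous_mk fun i => by
      refine (QuotientGroup.eq.2 ?_).symm
      change (sigma n i)⁻¹ * (α : MulAut (ProfiniteBraidGroup n)) (sigma n i) ∈ _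
      rw [h, inv_mul_cancel_left, zetaClosure, ← SetLike.mem_coe,
        topologicalClosure_zpowers_eq_range_profinitePow]
      exact Set.mem_range_self e
  exact DFunLike.congr_fun heq

theorem exists_map_sigma (hn : 2 ≤ n) {α : ContAut (ProfiniteBraidGroup n)}
    (hα : α ∈ quotientAutKer (zetaClosure n)) :
    ∃ e : ProfiniteInt, ∀ i, (α : MulAut (ProfiniteBraidGroup n)) (sigma n i) =
      sigma n i * profinitePow (zeta n) e := by
  rw [mem_quotientAutKer_iff] at hα
  have hex : ∀ i, ∃ e : ProfiniteInt, (α : MulAut (ProfiniteBraidGroup n)) (sigma n i) =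
      sigma n i * profinitePow (zeta n) e := fun i => by
    have h := QuotientGroup.eq.1 (hα (sigma n i)).symm
    rw [zetaClosure, ← SetLike.mem_coe, topologicalClosure_zpowers_eq_range_profinitePow] at h
    obtain ⟨e, he⟩ := h
    exact ⟨e, by rw [he, mul_inv_cancel_left]⟩
  choose e he using hex
  have hstep : ∀ i j : Fin (n - 1), (i : ℕ) + 1 = j → e i = e j := fun i j hij => by
    have h := congrArg (α : MulAut (ProfiniteBraidGroup n)) (sigma_braid n i j hij)
    rw [map_mul, map_mul, map_mul, map_mul, he, he] at h
    simp only [mul_zeta_pow_mul_mul_zeta_pow, sigma_braid n i j hij] at h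
    have h' := profinitePow_zeta_injective hn (mul_left_cancel h)
    -- The relation equates 2e_i + e_j with e_i + 2e_j.
    linear_combination h'
  have hpos : 0 < n - 1 := by omega
  have hconst : ∀ (k : ℕ) (hk : k < n - 1), e ⟨k, hk⟩ = e ⟨0, hpos⟩ := by
    intro k
    induction k with
    | zero => exact fun _ => rfl
    | succ k ih => exact fun hk => (hstep ⟨k, by omega⟩ ⟨k + 1, hk⟩ rfl).symm.trans (ih _)
  exact ⟨e ⟨0, hpos⟩, fun i => by rw [he, ← hconst i i.2]⟩

theorem exists_unit_of_mem_quotientAutKer (hn : 2 ≤ n) {α : ContAut (ProfiniteBraidGroup n)}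
    (hα : α ∈ quotientAutKer (zetaClosure n)) :
    ∃ (ν : congruenceUnits n) (e : ProfiniteInt),
      ((ν : ProfiniteIntˣ) : ProfiniteInt) = 1 + ((n * (n - 1) : ℕ) : ProfiniteInt) * e ∧
      ∀ i, (α : MulAut (ProfiniteBraidGroup n)) (sigma n i) =
        sigma n i * profinitePow (zeta n) e := by
  obtain ⟨e, he⟩ := exists_map_sigma hn hα
  obtain ⟨e', he'⟩ := exists_map_sigma hn (inv_mem hα)
  have hcomp := comp_map_sigma (f := (α : MulAut (ProfiniteBraidGroup n)).toMonoidHom)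
    (g := ((α⁻¹ : ContAut (ProfiniteBraidGroup n)) : MulAut (ProfiniteBraidGroup n)).toMonoidHom)
    α.2.1 he he' ⟨0, by omega⟩
  have hsum : e + (1 + ((n * (n - 1) : ℕ) : ProfiniteInt) * e) * e' = 0 := by
    refine profinitePow_zeta_injective hn ?_
    rw [profinitePow_zero]
    exact mul_eq_left.1 (hcomp.symm.trans
      ((α : MulAut (ProfiniteBraidGroup n)).apply_symm_apply _))
  -- The product expands to 1 + n(n-1)(e + e' + n(n-1)ee').
  have hmul : (1 + ((n * (n - 1) : ℕ) : ProfiniteInt) * e) *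
      (1 + ((n * (n - 1) : ℕ) : ProfiniteInt) * e') = 1 := by
    linear_combination ((n * (n - 1) : ℕ) : ProfiniteInt) * hsum
  exact ⟨⟨Units.mkOfMulEqOne _ _ hmul, mem_congruenceUnits_iff.2 ⟨e, rfl⟩⟩, e, rfl, he⟩

end ProfiniteBraidGroup

/-! ### The isomorphism from congruence units to the kernel -/

open ProfiniteBraidGroup in
theorem mainTheorem10 (n : ℕ) (hn : 2 ≤ n) :
    (∀ ν : congruenceUnits n, ∃! e : ProfiniteInt,
      ((ν : ProfiniteIntˣ) : ProfiniteInt) = 1 + ((n * (n - 1) : ℕ) : ProfiniteInt) * e) ∧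
    (∀ (ν : congruenceUnits n) (e : ProfiniteInt),
      ((ν : ProfiniteIntˣ) : ProfiniteInt) = 1 + ((n * (n - 1) : ℕ) : ProfiniteInt) * e →
      ∃! α : ContAut (ProfiniteBraidGroup n), ∀ i : Fin (n - 1),
        (α : MulAut (ProfiniteBraidGroup n)) (sigma n i) =
          sigma n i * profinitePow (zeta n) e) ∧
    ∃ φ : congruenceUnits n ≃* quotientAutKer (zetaClosure n),
      ∀ (ν : congruenceUnits n) (e : ProfiniteInt),
        ((ν : ProfiniteIntˣ) : ProfiniteInt) = 1 + ((n * (n - 1) : ℕ) : ProfiniteInt) * e →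
        ∀ i : Fin (n - 1),
          ((φ ν : ContAut (ProfiniteBraidGroup n)) : MulAut (ProfiniteBraidGroup n)) (sigma n i) =
            sigma n i * profinitePow (zeta n) e := by
  have hpos : 0 < n * (n - 1) := Nat.mul_pos (by omega) (by omega)
  have hinj : ∀ {a b : ProfiniteInt}, 1 + ((n * (n - 1) : ℕ) : ProfiniteInt) * a =
      1 + ((n * (n - 1) : ℕ) : ProfiniteInt) * b → a = b := fun {a b} h =>
    sub_eq_zero.1 (ProfiniteInt.natCast_mul_eq_zero hpos (by linear_combination h))
  refine ⟨fun ν => ?_, fun ν e he => ?_, ?_⟩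
  · obtain ⟨e, he⟩ := mem_congruenceUnits_iff.1 ν.2
    exact ⟨e, he, fun e' he' => hinj (he'.symm.trans he)⟩
  · obtain ⟨α, hα⟩ := exists_contAut_of_unit hn he
    exact ⟨α, hα, fun β hβ => contAut_ext fun i => (hβ i).trans (hα i).symm⟩
  -- The exponent is unique by `hinj`, so nothing depends on these choices.
  · choose e he using fun ν : congruenceUnits n => mem_congruenceUnits_iff.1 ν.2
    choose φ hφ using fun ν : congruenceUnits n => exists_contAut_of_unit hn (he ν)
    have hmul : ∀ μ ν, φ (μ * ν) = φ μ * φ ν := fun μ ν => contAut_ext fun i => by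
      refine (hφ _ i).trans (Eq.trans ?_ (comp_map_sigma
        (f := (φ μ : MulAut (ProfiniteBraidGroup n)).toMonoidHom)
        (g := (φ ν : MulAut (ProfiniteBraidGroup n)).toMonoidHom)
        (φ μ).2.1 (hφ μ) (hφ ν) i).symm)
      have h : ((μ : ProfiniteIntˣ) : ProfiniteInt) * ((ν : ProfiniteIntˣ) : ProfiniteInt) =
          1 + ((n * (n - 1) : ℕ) : ProfiniteInt) * e (μ * ν) := he (μ * ν)
      rw [he μ, he ν] at h
      congr 2
      exact hinj (by linear_combination -h)
    let Φ : congruenceUnits n →* quotientAutKer (zetaClosure n) :=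
      MonoidHom.mk' (fun ν => ⟨φ ν, mem_quotientAutKer_of_map_sigma (hφ ν)⟩)
        fun μ ν => Subtype.ext (hmul μ ν)
    have hΦ : Function.Bijective Φ := by
      constructor
      · intro μ ν h
        have h1 : φ μ = φ ν := congrArg Subtype.val h
        -- One generator suffices to recover the exponent, and n ≥ 2 provides it.
        have h2 := (hφ μ ⟨0, by omega⟩).symm.trans (h1 ▸ hφ ν ⟨0, by omega⟩)
        have h3 := profinitePow_zeta_injective hn (mul_left_cancel h2)
        exact Subtype.ext (Units.ext (by rw [he, he, h3]))
      · rintro ⟨α, hα⟩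
        obtain ⟨ν, a, ha, hαs⟩ := exists_unit_of_mem_quotientAutKer hn hα
        have hae : e ν = a := hinj ((he ν).symm.trans ha)
        exact ⟨ν, Subtype.ext (contAut_ext fun i => by rw [hαs, ← hae]; exact hφ ν i)⟩
    refine ⟨MulEquiv.ofBijective Φ hΦ, fun ν a ha i => ?_⟩
    rw [← hinj ((he ν).symm.trans ha)]
    exact hφ ν i
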